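/- Let $K$ be a class of partial functions $\mathbb{N}^k \rightharpoonup \mathbb{N}$ (of arbitrary arities $k$) satisfying the following three conditions. (1) (Closure) $K$ contains all partial recursive functions and is closed under substitution, primitive recursion and the $\mu$-operator, where the $\mu$-operator takes a partial function $f(y,v)$ to the partial function sending $v$ to the least $y$ such that $f(y,v)=0$ and $f(z,v)$ is defined and nonzero for all $z<y$. (2) (Computation records) For every unary $f\in K$ there are a set $M\subseteq\mathbb{N}$ and unary functions $\alpha,\omega\in K$ whose domains contain $M$ such that the indicator function of $M$ (equal to $1$ on $M$ and to $0$ outside $M$) belongs to $K$ and, for all $x,y\in\mathbb{N}$, $f(x)$ is defined and equal to $y$ if and only if there is some $m\in M$ with $\alpha(m)=x$ and $\omega(m)=y$. (3) (Programs) There is a binary function $F\in K$ such that for every unary $f\in K$ there is some $n\in\mathbb{N}$ for which $F(n,\cdot)$ and $f$ coincide as partial functions. Then there is a set $A\subseteq\mathbb{N}$ such that, for every $k$ and every partial function $f\colon\mathbb{N}^k\rightharpoonup\mathbb{N}$, the following are equivalent: (a) $f\in K$; (b) $f$ is partial recursive relative to (the indicator function of) $A$; (c) the graph of $f$ is enumeration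 reducible to $A\oplus\overline{A}$. Here $\overline{A}=\mathbb{N}\setminus A$, $A\oplus B=\{2n\mid n\in A\}\cup\{2n+1\mid n\in B\}$, and a set $S$ is enumeration reducible to a set $T$ if there is a recursively enumerable set $W$ of pairs $(x,D)$, $D$ finite, such that $x\in S$ if and only if $(x,D)\in W$ for some finite $D\subseteq T$ (tuples of numbers and finite sets being coded by numbers in a standard recursive way). -/

import Mathlib

namespace FunClass

/-- A class of partial functions with natural arguments and values, of arbitrary arities:
`K k` is the set of the `k`-ary members of the class. -/
abbrev PFunClass : Type := ∀ k : ℕ, Set (List.Vector ℕ k →. ℕ)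

/-- Substitution: `v ↦ f (g₁ v, …, gₘ v)`, defined exactly when all `gᵢ v` are defined and `f` is
defined on the tuple of their values. -/
def subst {m n : ℕ} (f : List.Vector ℕ m →. ℕ) (g : Fin m → (List.Vector ℕ n →. ℕ)) :
    List.Vector ℕ n →. ℕ :=
  fun v => (List.Vector.mOfFn fun i => g i v).bind f

/-- The value of the function `h` defined by primitive recursion from `f` and `g`:
`h (0, v) = f v` and `h (y + 1, v) = g (y, h (y, v), v)`. -/
def primRecVal {n : ℕ} (f : List.Vector ℕ n →. ℕ) (g : List.Vector ℕ (n + 2) →. ℕ)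
    (v : List.Vector ℕ n) : ℕ → Part ℕ
  | 0 => f v
  | y + 1 => (primRecVal f g v y).bind fun i => g (y ::ᵥ i ::ᵥ v)

/-- Primitive recursion, with the recursion variable as the first argument. -/
def primRec {n : ℕ} (f : List.Vector ℕ n →. ℕ) (g : List.Vector ℕ (n + 2) →. ℕ) :
    List.Vector ℕ (n + 1) →. ℕ :=
  fun w => primRecVal f g w.tail w.head

/-- The `μ`-operator: `v ↦` the least `y` such that `f (y, v) = 0` and `f (z, v)` is defined (and
nonzero) for all `z < y`; undefined if there is no such `y`. -/
def mu {n : ℕ} (f : List.Vector ℕ (n + 1) →. ℕ) : List.Vector ℕ n →. ℕ :=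
  fun v => Nat.rfind fun y => (f (y ::ᵥ v)).map fun m => decide (m = 0)

/-- The indicator function of a set of natural numbers: `1` on the set and `0` outside it. -/
noncomputable def indicatorFun (M : Set ℕ) : ℕ → ℕ := M.indicator fun _ => 1

/-- The unary member, in vector form, given by a partial function `ℕ →. ℕ`. -/
def unary (f : ℕ →. ℕ) : List.Vector ℕ 1 →. ℕ := fun v => f v.head

/-- A set is `K`-decidable if its indicator function belongs to `K`. -/
def KDecidable (K : PFunClass) (M : Set ℕ) : Prop :=
  unary (indicatorFun M : ℕ →. ℕ) ∈ K 1

/-- Closure properties: the class contains all partial recursive functions and is closed under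
substitution, primitive recursion and the `μ`-operator. -/
structure ClosureProperties (K : PFunClass) : Prop where
  partrec : ∀ (k : ℕ) (f : List.Vector ℕ k →. ℕ), Partrec f → f ∈ K k
  subst : ∀ (m n : ℕ) (f : List.Vector ℕ m →. ℕ) (g : Fin m → (List.Vector ℕ n →. ℕ)),
    f ∈ K m → (∀ i, g i ∈ K n) → subst f g ∈ K n
  primRec : ∀ (n : ℕ) (f : List.Vector ℕ n →. ℕ) (g : List.Vector ℕ (n + 2) →. ℕ),
    f ∈ K n → g ∈ K (n + 2) → primRec f g ∈ K (n + 1)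
  mu : ∀ (n : ℕ) (f : List.Vector ℕ (n + 1) →. ℕ), f ∈ K (n + 1) → mu f ∈ K n

/-- The axiom of computation records. -/
def ComputationRecords (K : PFunClass) : Prop :=
  ∀ f : ℕ →. ℕ, unary f ∈ K 1 →
    ∃ (M : Set ℕ) (α ω : ℕ →. ℕ), unary α ∈ K 1 ∧ unary ω ∈ K 1 ∧
      M ⊆ α.Dom ∧ M ⊆ ω.Dom ∧ KDecidable K M ∧
      ∀ x y : ℕ, y ∈ f x ↔ ∃ m ∈ M, x ∈ α m ∧ y ∈ ω m

/-- The axiom of programs: the class has a binary function that is universal for its unary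
members. -/
def Programs (K : PFunClass) : Prop :=
  ∃ F ∈ K 2, ∀ f : ℕ →. ℕ, unary f ∈ K 1 →
    ∃ n : ℕ, ∀ x : ℕ, F (n ::ᵥ x ::ᵥ List.Vector.nil) = f x

/-- The graph of a `k`-ary partial function, as a set of pairs (tuple of arguments, value). -/
def graph {k : ℕ} (f : List.Vector ℕ k →. ℕ) : Set (List.Vector ℕ k × ℕ) :=
  {p | p.2 ∈ f p.1}

/-- Enumeration reducibility of `S` to `T`: for some recursively enumerable `W`, `x ∈ S` if and
only if `(x, D) ∈ W` for some finite `D ⊆ T`. The finite sets `D` are given as lists of their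
elements, and the elements of `α` and `β` (numbers, tuples of numbers) are identified with their
numbers in the standard recursive encodings. -/
def EnumReducible {α β : Type} [Primcodable α] [Primcodable β] (S : Set α) (T : Set β) : Prop :=
  ∃ W : Set (α × List β), REPred (fun p => p ∈ W) ∧
    ∀ x, x ∈ S ↔ ∃ D : List β, (x, D) ∈ W ∧ ∀ b ∈ D, b ∈ T

/-- `A ⊕ B = {2n ∣ n ∈ A} ∪ {2n + 1 ∣ n ∈ B}`. -/
def join (A B : Set ℕ) : Set ℕ :=
  {m | ∃ n ∈ A, m = 2 * n} ∪ {m | ∃ n ∈ B, m = 2 * n + 1}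

/-- The partial function `f` is partial recursive relative to the set `A`, that is, relative to
the (total) indicator function of `A`. -/
def PartrecRelative {k : ℕ} (A : Set ℕ) (f : List.Vector ℕ k →. ℕ) : Prop :=
  RecursiveIn {(indicatorFun A : ℕ →. ℕ)} f

end FunClass

/-! Programs yield one unary `U ∈ K`, `U ⟨n, x⟩ = F (n, x)`, from which every unary member arises by
fixing `n`; other arities reduce to this by coding tuples. The graph of `U` cannot serve directly as
the oracle, since in general it is only enumerable from within `K`, not `K`-decidable. Computation
records repair this: they give a total `h ∈ K` that lists the graph of `U` (`exists_recordFun`).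
Take `A` to be the graph of `h`. As `h` is total, `A` is `K`-decidable, so everything recursive in
`A` lies in `K` by closure. Conversely `A` computes `h` by search, `h` computes `U` by search, and
`U` computes all of `K`.

The equivalence of (b) and (c) holds for every `A`. A convergent computation from `A` consults
finitely many oracle values, each determined by one element of `A ⊕ Aᶜ`; `FiniteApprox` carries this
through the inductive definition of relative recursion. Conversely, with oracle `A` one can search
for a value `y`, a finite set `D` and an enumeration stage at which `((v, y), D)` appears in `W` and
`D ⊆ A ⊕ Aᶜ`. -/

namespace FunClass

open Encodable Filter

/-! ### Closure of the class under relative recursion. -/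

namespace ClosureProperties

variable {K : PFunClass}

theorem mem_of_eq {n : ℕ} {f g : List.Vector ℕ n →. ℕ} (hf : f ∈ K n) (h : ∀ v, f v = g v) :
    g ∈ K n :=
  (funext h : f = g) ▸ hf

theorem comp_one (hK : ClosureProperties K) {n : ℕ} {f : ℕ →. ℕ} {g : List.Vector ℕ n →. ℕ}
    (hf : unary f ∈ K 1) (hg : g ∈ K n) : (fun v => (g v).bind f) ∈ K n := by
  refine mem_of_eq (hK.subst 1 n (unary f) (fun _ => g) hf (fun _ => hg)) fun v => ?_
  simp only [FunClass.subst, List.Vector.mOfFn, Part.pure_eq_some, Part.bind_eq_bind,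
    Part.bind_some]
  refine (Part.bind_assoc _ _ _).trans (congrArg _ (funext fun a => ?_))
  exact Part.bind_some _ _

theorem comp_two (hK : ClosureProperties K) {n : ℕ} {f : List.Vector ℕ 2 →. ℕ}
    {g h : List.Vector ℕ n →. ℕ} (hf : f ∈ K 2) (hg : g ∈ K n) (hh : h ∈ K n) :
    (fun v => (g v).bind fun a => (h v).bind fun b => f (a ::ᵥ b ::ᵥ List.Vector.nil)) ∈ K n := by
  refine mem_of_eq (hK.subst 2 n f ![g, h] hf (by intro i; fin_cases i <;> assumption))
    fun v => ?_
  simp only [FunClass.subst, List.Vector.mOfFn, Part.pure_eq_some, Part.bind_eq_bind,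
    Part.bind_some]
  refine (Part.bind_assoc _ _ _).trans (congrArg _ (funext fun a => ?_))
  rw [Part.bind_assoc]
  refine (Part.bind_assoc _ _ _).trans (congrArg _ (funext fun b => ?_))
  rw [Part.bind_some]
  exact Part.bind_some _ _

theorem computable (hK : ClosureProperties K) {n : ℕ} {f : List.Vector ℕ n → ℕ}
    (hf : Computable f) : (fun v => Part.some (f v)) ∈ K n :=
  hK.partrec n _ hf

theorem unary_of_partrec (hK : ClosureProperties K) {f : ℕ →. ℕ} (hf : Nat.Partrec f) :
    unary f ∈ K 1 :=
  hK.partrec 1 _ ((Partrec.nat_iff.2 hf).comp Computable.vector_head)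

theorem comp_computable (hK : ClosureProperties K) {n : ℕ} {f : ℕ →. ℕ}
    {g : List.Vector ℕ n → ℕ} (hf : unary f ∈ K 1) (hg : Computable g) :
    (fun v => f (g v)) ∈ K n :=
  mem_of_eq (hK.comp_one hf (hK.computable hg)) fun v => Part.bind_some (g v) f

/-- The unary members of the class are closed under relative recursion. -/
theorem unary_of_recursiveIn (hK : ClosureProperties K) {f : ℕ →. ℕ}
    (hf : Nat.RecursiveIn {g | unary g ∈ K 1} f) : unary f ∈ K 1 := by
  induction hf with
  | zero => exact hK.unary_of_partrec .zero
  | succ => exact hK.unary_of_partrec .succ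
  | left => exact hK.unary_of_partrec .left
  | right => exact hK.unary_of_partrec .right
  | oracle g hg => exact hg
  | @pair f h _ _ hf hh =>
    have hp : (fun v : List.Vector ℕ 2 => Part.some (Nat.pair v.head v.tail.head)) ∈ K 2 :=
      hK.computable (Primrec₂.natPair.to_comp.comp Computable.vector_head
        (Computable.vector_head.comp Computable.vector_tail))
    refine mem_of_eq (hK.comp_two hp hf hh) fun v => ?_
    simp [unary, Seq.seq, Part.bind_some_eq_map, Part.bind_map]
  | comp _ _ hf hh => exact hK.comp_one hf hh
  | @prec f h _ _ hf hh =>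
    -- `FunClass.primRec` supplies the arguments in the order `(y, i, a)`, while
    -- `Nat.RecursiveIn.prec` expects `⟨a, ⟨y, i⟩⟩`.
    have hg : (fun v : List.Vector ℕ 3 =>
        h (Nat.pair v.tail.tail.head (Nat.pair v.head v.tail.head))) ∈ K 3 :=
      hK.comp_computable hh <| Primrec₂.natPair.to_comp.comp
        (Computable.vector_head.comp (Computable.vector_tail.comp Computable.vector_tail))
        (Primrec₂.natPair.to_comp.comp Computable.vector_head
          (Computable.vector_head.comp Computable.vector_tail))
    have hu : Computable fun v : List.Vector ℕ 1 => v.head.unpair :=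
      Computable.unpair.comp Computable.vector_head
    refine mem_of_eq (hK.comp_two (hK.primRec 1 _ _ hf hg)
      (hK.computable (Computable.snd.comp hu)) (hK.computable (Computable.fst.comp hu)))
      fun v => ?_
    simp only [unary, FunClass.primRec, Part.bind_some, List.Vector.head_cons,
      List.Vector.tail_cons]
    induction v.head.unpair.2 with
    | zero => rfl
    | succ n ih =>
      refine (congrArg (fun p => Part.bind p _) ih).trans ?_
      simp
  | @rfind f _ hf =>
    have hg : (fun v : List.Vector ℕ 2 => f (Nat.pair v.tail.head v.head)) ∈ K 2 :=
      hK.comp_computable hf <| Primrec₂.natPair.to_comp.comp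
        (Computable.vector_head.comp Computable.vector_tail) Computable.vector_head
    exact hK.mu 1 _ hg

theorem mem_of_partrecRelative (hK : ClosureProperties K) {k : ℕ} {A : Set ℕ}
    (hA : KDecidable K A) {f : List.Vector ℕ k →. ℕ} (hf : PartrecRelative A f) : f ∈ K k := by
  have hu := hK.unary_of_recursiveIn (hf.mono (Set.singleton_subset_iff.2 hA))
  -- Relative recursiveness of `f` concerns its version on codes; precomposing with `encode`
  -- recovers `f`.
  have := hK.comp_computable hu (Computable.encode (α := List.Vector ℕ k))
  refine mem_of_eq this fun v => ?_
  simp [Part.map_id']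

end ClosureProperties

theorem KDecidable.of_recursiveIn {K : PFunClass} (hK : ClosureProperties K) {A : Set ℕ}
    (hA : Nat.RecursiveIn {g | unary g ∈ K 1} fun n => Part.some (indicatorFun A n)) : KDecidable K A :=
  hK.unary_of_recursiveIn hA

/-! ### Relative recursion with total functions, unbounded search, and graphs as oracles. -/

/-- The graph of a total function, as a set of codes of pairs. -/
def graphSet (h : ℕ → ℕ) : Set ℕ := {n | h n.unpair.1 = n.unpair.2}

theorem indicatorFun_graphSet (h : ℕ → ℕ) (n : ℕ) :
    indicatorFun (graphSet h) n = if h n.unpair.1 = n.unpair.2 then 1 else 0 := by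
  simp [indicatorFun, graphSet, Set.indicator_apply]

theorem recursiveIn_comp_computable {O : Set (ℕ →. ℕ)} {f : ℕ →. ℕ} {g : ℕ → ℕ}
    (hf : Nat.RecursiveIn O f) (hg : Computable g) : Nat.RecursiveIn O fun n => f (g n) :=
  (Nat.RecursiveIn.comp hf (Nat.Partrec.recursiveIn (Partrec.nat_iff.1 hg))).of_eq fun n =>
    Part.bind_some (g n) f

theorem recursiveIn_total_comp {O : Set (ℕ →. ℕ)} {f g : ℕ → ℕ}
    (hf : Nat.RecursiveIn O fun n => Part.some (f n)) (hg : Computable g) :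
    Nat.RecursiveIn O fun n => Part.some (f (g n)) :=
  recursiveIn_comp_computable (f := fun n => Part.some (f n)) hf hg

theorem recursiveIn_computable_comp {O : Set (ℕ →. ℕ)} {f : ℕ → ℕ} {g : ℕ →. ℕ}
    (hf : Computable f) (hg : Nat.RecursiveIn O g) : Nat.RecursiveIn O fun n => (g n).map f :=
  (Nat.RecursiveIn.comp (Nat.Partrec.recursiveIn (Partrec.nat_iff.1 hf)) hg).of_eq fun n =>
    Part.bind_some_eq_map f (g n)

theorem recursiveIn_pair {O : Set (ℕ →. ℕ)} {f g : ℕ → ℕ}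
    (hf : Nat.RecursiveIn O fun n => Part.some (f n))
    (hg : Nat.RecursiveIn O fun n => Part.some (g n)) :
    Nat.RecursiveIn O fun n => Part.some (Nat.pair (f n) (g n)) :=
  (hf.pair hg).of_eq fun n => by simp [Seq.seq]

theorem recursiveIn_id {O : Set (ℕ →. ℕ)} : Nat.RecursiveIn O fun n => Part.some n :=
  Nat.Partrec.recursiveIn Nat.Partrec.some

theorem computable_unpair_fst : Computable fun n : ℕ => n.unpair.1 :=
  Computable.fst.comp Computable.unpair

theorem computable_unpair_snd : Computable fun n : ℕ => n.unpair.2 :=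
  Computable.snd.comp Computable.unpair

/-- A single-valued relation of the form `∃ s, q x (h s) = some y` is recursive in `h`: search for
the first such `s`. -/
theorem recursiveIn_of_search {O : Set (ℕ →. ℕ)} {h : ℕ → ℕ}
    (hh : Nat.RecursiveIn O fun n => Part.some (h n)) {q : ℕ → ℕ → Option ℕ}
    (hq : Computable₂ q) {U : ℕ →. ℕ} (hU : ∀ x y, y ∈ U x ↔ ∃ s, q x (h s) = some y) :
    Nat.RecursiveIn O U := by
  have hqu : Computable fun n : ℕ => q n.unpair.1 n.unpair.2 :=
    hq.comp computable_unpair_fst computable_unpair_snd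
  have hp : Nat.RecursiveIn O fun n => Part.some (Nat.pair n.unpair.1 (h n.unpair.2)) :=
    recursiveIn_pair .left (recursiveIn_total_comp hh computable_unpair_snd)
  have hc : Computable fun n : ℕ => bif (q n.unpair.1 n.unpair.2).isSome then 0 else 1 :=
    Computable.cond (Primrec.option_isSome.to_comp.comp hqu) (.const 0) (.const 1)
  have hd : Computable fun n : ℕ => (q n.unpair.1 n.unpair.2).getD 0 :=
    Computable.option_getD hqu (.const 0)
  refine (Nat.RecursiveIn.comp (recursiveIn_computable_comp hd hp)
    (recursiveIn_id.pair (.rfind (recursiveIn_computable_comp hc hp)))).of_eq fun x => ?_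
  have hr : ∀ s, s ∈ Nat.rfind (fun n => (fun m => decide (m = 0)) <$> Part.map
      (fun n : ℕ => bif (q n.unpair.1 n.unpair.2).isSome then 0 else 1)
      (Part.some (Nat.pair (Nat.pair x n).unpair.1 (h (Nat.pair x n).unpair.2)))) ↔
      (q x (h s)).isSome ∧ ∀ t < s, q x (h t) = none := by
    intro s
    refine Nat.mem_rfind.trans (and_congr ?_ (forall₂_congr fun t _ => ?_))
    · cases hqs : q x (h s) <;> simp [hqs]
    · cases hqt : q x (h t) <;> simp [hqt]
  ext y
  simp only [Part.map_eq_map, Part.map_some, Seq.seq, Part.bind_eq_bind, Part.bind_some,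
    Part.mem_bind_iff, Part.mem_map_iff, Part.mem_some_iff, hU]
  constructor
  · rintro ⟨_, ⟨s, hs, rfl⟩, rfl⟩
    obtain ⟨y, hy⟩ := Option.isSome_iff_exists.1 ((hr s).1 hs).1
    exact ⟨s, by simp [hy]⟩
  · rintro ⟨s, hs⟩
    have hex : ∃ s, (q x (h s)).isSome := ⟨s, by simp [hs]⟩
    have hf := Nat.find_spec hex
    refine ⟨_, ⟨Nat.find hex, (hr _).2 ⟨hf, fun t ht => by simpa using Nat.find_min hex ht⟩,
      rfl⟩, ?_⟩
    obtain ⟨z, hz⟩ := Option.isSome_iff_exists.1 hf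
    -- The first hit may differ from the given witness, but `U` is single-valued.
    have : z = y := Part.mem_unique ((hU x z).2 ⟨_, hz⟩) ((hU x y).2 ⟨s, hs⟩)
    simp [hz, this]

theorem recursiveIn_graphSet {O : Set (ℕ →. ℕ)} {h : ℕ → ℕ}
    (hh : Nat.RecursiveIn O fun n => Part.some (h n)) :
    Nat.RecursiveIn O fun n => Part.some (indicatorFun (graphSet h) n) := by
  have hc : Computable fun n : ℕ => if n.unpair.1 = n.unpair.2 then 1 else 0 :=
    (Primrec.ite (Primrec.eq.comp (Primrec.fst.comp Primrec.unpair)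
      (Primrec.snd.comp Primrec.unpair)) (Primrec.const 1) (Primrec.const 0)).to_comp
  refine (recursiveIn_computable_comp hc (recursiveIn_pair
    (recursiveIn_total_comp hh computable_unpair_fst) .right)).of_eq fun n => ?_
  simp [indicatorFun_graphSet]

/-- Run through all `s = ⟨x', y⟩`, together with the oracle's answer on `s`, until `x' = x` and the
answer is `1`; totality of `h` makes this stop. -/
theorem recursiveIn_of_graphSet (h : ℕ → ℕ) :
    Nat.RecursiveIn {(indicatorFun (graphSet h) : ℕ →. ℕ)} fun n => Part.some (h n) := by
  have hg : Nat.RecursiveIn {(indicatorFun (graphSet h) : ℕ →. ℕ)}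
      fun n => Part.some (indicatorFun (graphSet h) n) := .oracle _ (Set.mem_singleton _)
  have hq : Computable₂ fun x n : ℕ =>
      if n.unpair.2 = 1 ∧ n.unpair.1.unpair.1 = x then some n.unpair.1.unpair.2 else none := by
    have l : Primrec fun n : ℕ => n.unpair.1 := Primrec.fst.comp Primrec.unpair
    have r : Primrec fun n : ℕ => n.unpair.2 := Primrec.snd.comp Primrec.unpair
    exact (Primrec.ite (.and (Primrec.eq.comp (r.comp .snd) (.const 1))
      (Primrec.eq.comp (l.comp (l.comp .snd)) .fst))
      (Primrec.option_some.comp (r.comp (l.comp .snd))) (.const none)).to_comp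
  refine recursiveIn_of_search (recursiveIn_pair recursiveIn_id hg) hq fun x y => ?_
  simp only [Part.mem_some_iff, Nat.unpair_pair, indicatorFun_graphSet]
  constructor
  · rintro rfl
    exact ⟨Nat.pair x (h x), by simp⟩
  · rintro ⟨s, hs⟩
    split_ifs at hs with h₁ h₂ h₂
    · rw [← h₂.2, h₁]
      exact (Option.some_inj.1 hs).symm
    · simp at h₂

/-! ### The oracle obtained from programs and computation records. -/

/-- The computation records of a function can be listed by a total function. -/
theorem exists_recordFun {K : PFunClass} (hR : ComputationRecords K) {U : ℕ →. ℕ}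
    (hU : unary U ∈ K 1) :
    ∃ h : ℕ → ℕ, (Nat.RecursiveIn {g | unary g ∈ K 1} fun n => Part.some (h n)) ∧
      ∀ x y, y ∈ U x ↔ ∃ m, h m = Nat.pair x y + 1 := by
  classical
  obtain ⟨M, α, ω, hα, hω, hMα, hMω, hM, H⟩ := hR U hU
  -- The shift by one reserves `0` for numbers that are not records, since `Nat.pair 0 0 = 0`.
  have hval : ∀ m, ∃ n, (m ∈ M → ∃ x y, x ∈ α m ∧ y ∈ ω m ∧ n = Nat.pair x y + 1) ∧
      (m ∉ M → n = 0) := by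
    intro m
    by_cases hm : m ∈ M
    · obtain ⟨x, hx⟩ := Part.dom_iff_mem.1 (hMα hm)
      obtain ⟨y, hy⟩ := Part.dom_iff_mem.1 (hMω hm)
      exact ⟨Nat.pair x y + 1, fun _ => ⟨x, y, hx, hy, rfl⟩, fun h => absurd hm h⟩
    · exact ⟨0, fun h => absurd h hm, fun _ => rfl⟩
  choose h h₁ h₀ using hval
  refine ⟨h, ?_, fun x y => ?_⟩
  · have hs : Nat.RecursiveIn {g | unary g ∈ K 1}
        fun m => (Nat.pair <$> α m <*> ω m) >>= fun n => Part.some (n + 1) :=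
      .comp .succ (.pair (.oracle _ hα) (.oracle _ hω))
    have h0 : Nat.RecursiveIn {g | unary g ∈ K 1} fun _ => Part.some 0 := .zero
    have hM : Nat.RecursiveIn {g | unary g ∈ K 1} fun n => Part.some (indicatorFun M n) :=
      .oracle _ hM
    -- Case distinction by primitive recursion with the indicator of `M` as the number of steps: `α`
    -- and `ω`, possibly undefined outside `M`, are called only on `M`.
    have hp := Nat.RecursiveIn.prec h0 (recursiveIn_comp_computable hs computable_unpair_fst)
    refine (Nat.RecursiveIn.comp hp (recursiveIn_pair recursiveIn_id hM)).of_eq fun m => ?_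
    by_cases hm : m ∈ M
    · obtain ⟨x, y, hx, hy, e⟩ := h₁ m hm
      rw [← Part.eq_some_iff] at hx hy
      simp [indicatorFun, hm, hx, hy, e, Seq.seq]
    · simp [indicatorFun, hm, h₀ m hm]
  · rw [H]
    constructor
    · rintro ⟨m, hm, hx, hy⟩
      obtain ⟨x', y', hx', hy', e⟩ := h₁ m hm
      exact ⟨m, by rw [e, Part.mem_unique hx hx', Part.mem_unique hy hy']⟩
    · rintro ⟨m, e⟩
      have hm : m ∈ M := by
        by_contra hm
        simp [h₀ m hm] at e
      obtain ⟨x', y', hx', hy', e'⟩ := h₁ m hm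
      have := e.symm.trans e'
      simp only [Nat.add_right_cancel_iff, Nat.pair_eq_pair] at this
      exact ⟨m, hm, this.1 ▸ hx', this.2 ▸ hy'⟩

theorem recursiveIn_of_recordFun {O : Set (ℕ →. ℕ)} {h : ℕ → ℕ}
    (hh : Nat.RecursiveIn O fun n => Part.some (h n)) {U : ℕ →. ℕ}
    (hU : ∀ x y, y ∈ U x ↔ ∃ m, h m = Nat.pair x y + 1) : Nat.RecursiveIn O U := by
  have hq : Computable₂ fun x n : ℕ =>
      if n = Nat.pair x (n - 1).unpair.2 + 1 then some (n - 1).unpair.2 else none := by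
    have r : Primrec fun p : ℕ × ℕ => (p.2 - 1).unpair.2 :=
      (Primrec.snd.comp Primrec.unpair).comp (Primrec.nat_sub.comp .snd (.const 1))
    exact (Primrec.ite (Primrec.eq.comp .snd (Primrec.succ.comp (Primrec₂.natPair.comp .fst r)))
      (Primrec.option_some.comp r) (.const none)).to_comp
  refine recursiveIn_of_search hh hq fun x y => (hU x y).trans (exists_congr fun m => ?_)
  constructor
  · intro e
    simp [e]
  · intro e
    split_ifs at e with h₁
    rwa [Option.some_inj.1 e] at h₁

/-- The function on tuples obtained by decoding belongs to the class. -/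
theorem ClosureProperties.unary_decode {K : PFunClass} (hK : ClosureProperties K) {k : ℕ}
    {f : List.Vector ℕ k →. ℕ} (hf : f ∈ K k) :
    unary (fun n => f ((decode n).getD default)) ∈ K 1 := by
  -- The coordinates must be total computable functions, so numbers coding no tuple are sent to
  -- `default`; later only codes are used.
  have hd : Computable fun v : List.Vector ℕ 1 =>
      ((decode v.head).getD default : List.Vector ℕ k) :=
    Computable.option_getD (Computable.decode.comp Computable.vector_head) (.const _)
  refine mem_of_eq (hK.subst k 1 f (fun i v => Part.some
    (((decode v.head).getD default : List.Vector ℕ k).get i)) hf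
    fun i => hK.computable (Computable.vector_get.comp hd (.const i))) fun v => ?_
  simp only [FunClass.subst, Vector.mOfFn_part_some, List.Vector.ofFn_get]
  exact Part.bind_some _ f

/-- There is an oracle which computes exactly the members of the class. -/
theorem exists_forall_mem_iff_partrecRelative {K : PFunClass} (hK : ClosureProperties K)
    (hR : ComputationRecords K) (hP : Programs K) :
    ∃ A : Set ℕ, ∀ (k : ℕ) (f : List.Vector ℕ k →. ℕ), f ∈ K k ↔ PartrecRelative A f := by
  obtain ⟨F, hF, hFU⟩ := hP
  have hU : unary (fun n => F (n.unpair.1 ::ᵥ n.unpair.2 ::ᵥ List.Vector.nil)) ∈ K 1 := by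
    refine ClosureProperties.mem_of_eq (hK.comp_two hF
      (hK.computable (computable_unpair_fst.comp Computable.vector_head))
      (hK.computable (n := 1) (computable_unpair_snd.comp Computable.vector_head))) fun v => ?_
    simp [unary]
  obtain ⟨h, hh, hhU⟩ := exists_recordFun hR hU
  refine ⟨graphSet h, fun k f => ⟨fun hf => ?_, hK.mem_of_partrecRelative
    (.of_recursiveIn hK (recursiveIn_graphSet hh))⟩⟩
  obtain ⟨n, hn⟩ := hFU _ (hK.unary_decode hf)
  have hu := recursiveIn_of_recordFun (recursiveIn_of_graphSet h) hhU
  -- Here a number coding no tuple must give an undefined value, as in the definition of relative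
  -- recursiveness.
  have hd : Partrec fun m => ((decode m : Option (List.Vector ℕ k)) : Part (List.Vector ℕ k)) :=
    Computable.decode.ofOption
  have hc := Partrec.nat_iff.1 (hd.map
    (Primrec₂.natPair.to_comp.comp (.const n) (Computable.encode.comp .snd)).to₂)
  refine (Nat.RecursiveIn.comp hu hc.recursiveIn).of_eq fun m => ?_
  simp [Part.bind_map, hn, Part.map_id']

/-! ### Finite approximations: relative computations as enumeration operators. -/

/-- `g D` computes, from the information that the elements of the finite list `D` belong to `T`,
a part of the partial function `f`, and every value of `f` is computed from all sufficiently large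
finite subsets of `T`. -/
structure FiniteApprox (T : Set ℕ) (g : List ℕ → ℕ →. ℕ) (f : ℕ →. ℕ) : Prop where
  partrec : Partrec₂ g
  sound : ∀ D : List ℕ, (∀ b ∈ D, b ∈ T) → ∀ x y, y ∈ g D x → y ∈ f x
  complete : ∀ x y, y ∈ f x → ∀ᶠ D : Finset T in atTop, y ∈ g (D.toList.map Subtype.val) x

theorem FiniteApprox.of_partrec {T : Set ℕ} {f : ℕ →. ℕ} (hf : Nat.Partrec f) :
    FiniteApprox T (fun _ => f) f where
  partrec := (Partrec.nat_iff.2 hf).comp Computable.snd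
  sound _ _ _ _ := id
  complete _ _ h := .of_forall fun _ => h

/-- The part of the indicator function of `A` which is determined by a finite list of elements of
`A ⊕ Aᶜ`. -/
def listIndicator (D : List ℕ) (n : ℕ) : Option ℕ :=
  if ∃ b ∈ D, b = 2 * n then some 1 else if ∃ b ∈ D, b = 2 * n + 1 then some 0 else none

theorem primrec_listIndicator : Primrec₂ listIndicator := by
  have hD : Primrec₂ fun (_ : List ℕ) (n : ℕ) => 2 * n :=
    Primrec.nat_mul.comp (.const 2) .snd
  have hR : PrimrecRel fun (l : List ℕ) (a : ℕ) => ∃ b ∈ l, b = a :=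
    PrimrecRel.exists_mem_list Primrec.eq
  exact Primrec.ite (hR.comp .fst hD) (.const _)
    (Primrec.ite (hR.comp .fst (Primrec.succ.comp hD)) (.const _) (.const _))

theorem two_mul_mem_join {A B : Set ℕ} {n : ℕ} : 2 * n ∈ join A B ↔ n ∈ A := by
  simp only [join, Set.mem_union, Set.mem_ofPred_eq]
  constructor
  · rintro (⟨m, hm, e⟩ | ⟨m, hm, e⟩)
    · rwa [show n = m by lia]
    · lia
  · exact fun h => .inl ⟨n, h, rfl⟩

theorem two_mul_add_one_mem_join {A B : Set ℕ} {n : ℕ} : 2 * n + 1 ∈ join A B ↔ n ∈ B := by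
  simp only [join, Set.mem_union, Set.mem_ofPred_eq]
  constructor
  · rintro (⟨m, hm, e⟩ | ⟨m, hm, e⟩)
    · lia
    · rwa [show n = m by lia]
  · exact fun h => .inr ⟨n, h, rfl⟩

/-- Exactly one of `2 * x` and `2 * x + 1` lies in `A ⊕ Aᶜ`, and any finite subset containing it
settles the value at `x`. -/
theorem finiteApprox_indicatorFun (A : Set ℕ) :
    FiniteApprox (join A Aᶜ) (fun D n => (listIndicator D n : Part ℕ))
      (indicatorFun A : ℕ →. ℕ) := by
  have hs : ∀ D : List ℕ, (∀ b ∈ D, b ∈ join A Aᶜ) → ∀ n y, listIndicator D n = some y →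
      indicatorFun A n = y := by
    intro D hD n y h
    unfold listIndicator at h
    split_ifs at h with h₁ h₂
    · obtain ⟨_, hb, rfl⟩ := h₁
      have : n ∈ A := two_mul_mem_join.1 (hD _ hb)
      simpa [indicatorFun, this] using h
    · obtain ⟨_, hb, rfl⟩ := h₂
      have : n ∉ A := two_mul_add_one_mem_join.1 (hD _ hb)
      simpa [indicatorFun, this] using h
  refine ⟨primrec_listIndicator.to_comp.ofOption, fun D hD x y h => ?_, fun x y h => ?_⟩
  · rw [Part.mem_ofOption] at h
    exact Part.mem_some_iff.2 (hs D hD x y h).symm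
  · obtain rfl := Part.mem_some_iff.1 h
    obtain ⟨b, hb, hb'⟩ : ∃ b ∈ join A Aᶜ, b = 2 * x ∨ b = 2 * x + 1 := by
      by_cases hx : x ∈ A
      · exact ⟨_, two_mul_mem_join.2 hx, .inl rfl⟩
      · exact ⟨_, two_mul_add_one_mem_join.2 hx, .inr rfl⟩
    filter_upwards [eventually_ge_atTop {⟨b, hb⟩}] with D hD
    have hbD : b ∈ D.toList.map Subtype.val := by
      simpa [hb] using hD
    have hex : ∃ z, listIndicator (D.toList.map Subtype.val) x = some z := by
      unfold listIndicator
      split_ifs with h₁ h₂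
      · exact ⟨_, rfl⟩
      · exact ⟨_, rfl⟩
      · rcases hb' with rfl | rfl
        · exact absurd ⟨_, hbD, rfl⟩ h₁
        · exact absurd ⟨_, hbD, rfl⟩ h₂
    obtain ⟨z, hz⟩ := hex
    rw [Part.mem_ofOption, hs _ (by simp +contextual) x z hz]
    exact hz

namespace FiniteApprox

variable {T : Set ℕ} {f h : ℕ →. ℕ} {g k : List ℕ → ℕ →. ℕ}

theorem pair (hf : FiniteApprox T g f) (hh : FiniteApprox T k h) :
    FiniteApprox T (fun D n => (g D n).bind fun a => (k D n).map fun b => Nat.pair a b)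
      (fun n => Nat.pair <$> f n <*> h n) := by
  have e : (fun n => Nat.pair <$> f n <*> h n) =
      fun n => (f n).bind fun a => (h n).map fun b => Nat.pair a b := by
    funext n
    simp [Seq.seq, Part.bind_map]
  rw [e]
  refine ⟨?_, fun D hD x y => ?_, fun x y => ?_⟩
  · exact Partrec.bind hf.partrec (Partrec.map (hh.partrec.comp
      (Computable.fst.comp .fst) (Computable.snd.comp .fst))
      (Primrec₂.natPair.to_comp.comp (Computable.snd.comp .fst) .snd).to₂)
  · simp only [Part.mem_bind_iff, Part.mem_map_iff]
    rintro ⟨a, ha, b, hb, rfl⟩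
    exact ⟨a, hf.sound D hD _ _ ha, b, hh.sound D hD _ _ hb, rfl⟩
  · simp only [Part.mem_bind_iff, Part.mem_map_iff]
    rintro ⟨a, ha, b, hb, rfl⟩
    filter_upwards [hf.complete _ _ ha, hh.complete _ _ hb] with D h₁ h₂
    exact ⟨a, h₁, b, h₂, rfl⟩

theorem comp (hf : FiniteApprox T g f) (hh : FiniteApprox T k h) :
    FiniteApprox T (fun D n => (k D n).bind (g D)) (fun n => h n >>= f) := by
  refine ⟨?_, fun D hD x y => ?_, fun x y => ?_⟩
  · exact Partrec.bind hh.partrec (hf.partrec.comp (Computable.fst.comp .fst) .snd)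
  · rintro h
    obtain ⟨a, ha, hy⟩ := Part.mem_bind_iff.1 h
    exact Part.mem_bind_iff.2 ⟨a, hh.sound D hD _ _ ha, hf.sound D hD _ _ hy⟩
  · rintro h
    obtain ⟨a, ha, hy⟩ := Part.mem_bind_iff.1 h
    filter_upwards [hh.complete _ _ ha, hf.complete _ _ hy] with D h₁ h₂
    exact Part.mem_bind_iff.2 ⟨a, h₁, h₂⟩

theorem prec (hf : FiniteApprox T g f) (hh : FiniteApprox T k h) :
    FiniteApprox T
      (fun D p => p.unpair.2.rec (g D p.unpair.1) fun y IH =>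
        IH.bind fun i => k D (Nat.pair p.unpair.1 (Nat.pair y i)))
      (fun p => p.unpair.2.rec (f p.unpair.1) fun y IH =>
        IH.bind fun i => h (Nat.pair p.unpair.1 (Nat.pair y i))) := by
  refine ⟨?_, fun D hD x => ?_, fun x => ?_⟩
  · have l : Computable fun p : List ℕ × ℕ => p.2.unpair.1 := computable_unpair_fst.comp .snd
    have r : Computable fun p : List ℕ × ℕ => p.2.unpair.2 := computable_unpair_snd.comp .snd
    refine Partrec.nat_rec r (hf.partrec.comp .fst l) (hh.partrec.comp
      (Computable.fst.comp .fst) (Primrec₂.natPair.to_comp.comp (l.comp .fst)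
        (Primrec₂.natPair.to_comp.comp (Computable.fst.comp .snd) (Computable.snd.comp .snd)))).to₂
  · induction x.unpair.2 with
    | zero => exact hf.sound D hD _
    | succ n ih =>
      intro y
      simp only [Part.mem_bind_iff]
      rintro ⟨i, hi, hy⟩
      exact ⟨i, ih i hi, hh.sound D hD _ _ hy⟩
  · induction x.unpair.2 with
    | zero => exact hf.complete _
    | succ n ih =>
      intro y
      simp only [Part.mem_bind_iff]
      rintro ⟨i, hi, hy⟩
      filter_upwards [ih i hi, hh.complete _ _ hy] with D h₁ h₂
      exact ⟨i, h₁, h₂⟩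

theorem rfind (hf : FiniteApprox T g f) :
    FiniteApprox T
      (fun D a => Nat.rfind fun n => (g D (Nat.pair a n)).map fun m => decide (m = 0))
      (fun a => Nat.rfind fun n => (f (Nat.pair a n)).map fun m => decide (m = 0)) := by
  refine ⟨?_, fun D hD x y hy => ?_, fun x y hy => ?_⟩
  · exact Partrec.rfind (Partrec.map (hf.partrec.comp (Computable.fst.comp .fst)
      (Primrec₂.natPair.to_comp.comp (Computable.snd.comp .fst) .snd))
      (Primrec.eq.decide.to_comp.comp .snd (.const 0)).to₂)
  · obtain ⟨h₁, h₂⟩ := Nat.mem_rfind.1 hy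
    refine Nat.mem_rfind.2 ⟨?_, fun {m} hm => ?_⟩
    · obtain ⟨z, hz, e⟩ := (Part.mem_map_iff _).1 h₁
      exact (Part.mem_map_iff _).2 ⟨z, hf.sound D hD _ _ hz, e⟩
    · obtain ⟨z, hz, e⟩ := (Part.mem_map_iff _).1 (h₂ hm)
      exact (Part.mem_map_iff _).2 ⟨z, hf.sound D hD _ _ hz, e⟩
  · obtain ⟨h₁, h₂⟩ := Nat.mem_rfind.1 hy
    obtain ⟨z, hz, e⟩ := (Part.mem_map_iff _).1 h₁
    -- Only finitely many values are needed below `y`, so one sufficiently large `D` serves them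
    -- all.
    have hlt : ∀ᶠ D : Finset T in atTop, ∀ m ∈ Set.Iio y,
        false ∈ (g (D.toList.map Subtype.val) (Nat.pair x m)).map fun m => decide (m = 0) := by
      refine (eventually_all_finite (Set.finite_Iio y)).2 fun m hm => ?_
      obtain ⟨z, hz, e⟩ := (Part.mem_map_iff _).1 (h₂ hm)
      filter_upwards [hf.complete _ _ hz] with D hD
      exact (Part.mem_map_iff _).2 ⟨z, hD, e⟩
    filter_upwards [hf.complete _ _ hz, hlt] with D h₁ h₂
    exact Nat.mem_rfind.2 ⟨(Part.mem_map_iff _).2 ⟨z, h₁, e⟩, fun hm => h₂ _ hm⟩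

end FiniteApprox

/-- Each rule combines finitely many values, and finitely many conditions on large `D` hold
simultaneously; hence no monotonicity of `g` in `D` is needed. -/
theorem exists_finiteApprox {A : Set ℕ} {f : ℕ →. ℕ}
    (hf : Nat.RecursiveIn {(indicatorFun A : ℕ →. ℕ)} f) :
    ∃ g, FiniteApprox (join A Aᶜ) g f := by
  induction hf with
  | zero => exact ⟨_, .of_partrec .zero⟩
  | succ => exact ⟨_, .of_partrec .succ⟩
  | left => exact ⟨_, .of_partrec .left⟩
  | right => exact ⟨_, .of_partrec .right⟩
  | oracle g hg =>
    obtain rfl := Set.mem_singleton_iff.1 hg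
    exact ⟨_, finiteApprox_indicatorFun A⟩
  | pair _ _ hf hh => exact hf.elim fun _ hf => hh.elim fun _ hh => ⟨_, hf.pair hh⟩
  | comp _ _ hf hh => exact hf.elim fun _ hf => hh.elim fun _ hh => ⟨_, hf.comp hh⟩
  | prec _ _ hf hh => exact hf.elim fun _ hf => hh.elim fun _ hh => ⟨_, hf.prec hh⟩
  | rfind _ hf => exact hf.elim fun _ hf => ⟨_, hf.rfind⟩

theorem rePred_mem {α : Type} [Primcodable α] {f : α →. ℕ} {g : α → ℕ} (hf : Partrec f)
    (hg : Computable g) : REPred fun a => g a ∈ f a := by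
  have hc : Computable fun p : α × ℕ => if p.2 = g p.1 then some () else none :=
    (Computable.cond (Primrec.eq.decide.to_comp.comp .snd (hg.comp .fst)) (.const (some ()))
      (.const none)).of_eq fun p => by by_cases h : p.2 = g p.1 <;> simp [h]
  have : Partrec fun a => (f a).bind fun y =>
      ((if y = g a then some () else none : Option Unit) : Part Unit) :=
    hf.bind hc.ofOption.to₂
  refine this.dom_re.of_eq fun a => ?_
  simp only [Part.dom_iff_mem, Part.mem_bind_iff, Part.mem_ofOption]
  constructor
  · rintro ⟨_, y, hy, h⟩
    split_ifs at h with e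
    · exact e ▸ hy
    · simp at h
  · exact fun h => ⟨(), _, h, by simp⟩

theorem PartrecRelative.enumReducible {k : ℕ} {A : Set ℕ} {f : List.Vector ℕ k →. ℕ}
    (hf : PartrecRelative A f) : EnumReducible (graph f) (join A Aᶜ) := by
  obtain ⟨g, hg⟩ := exists_finiteApprox hf
  refine ⟨{p | p.1.2 ∈ g p.2 (encode p.1.1)}, rePred_mem
    (hg.partrec.comp .snd (Computable.encode.comp (Computable.fst.comp .fst)))
    (Computable.snd.comp .fst), fun x => ⟨fun hx => ?_, fun ⟨D, hD, hT⟩ => ?_⟩⟩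
  · have hx : x.2 ∈ f x.1 := hx
    obtain ⟨D, hD⟩ := (hg.complete (encode x.1) x.2 (by simpa using hx)).exists
    exact ⟨_, hD, by simp +contextual⟩
  · simpa [graph] using hg.sound D hT _ _ hD

/-! ### From enumeration reducibility to relative computation. -/

/-- A recursively enumerable predicate is the projection of a primitive recursive one. -/
theorem REPred.exists_primrec {α : Type} [Primcodable α] {p : α → Prop} (hp : REPred p) :
    ∃ q : α → ℕ → Bool, Primrec₂ q ∧ ∀ a, p a ↔ ∃ s, q a s = true := by
  obtain ⟨c, hc⟩ := Nat.Partrec.Code.exists_code.1 hp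
  refine ⟨fun a s => (c.evaln s (encode a)).isSome, Primrec.option_isSome.comp
    (Nat.Partrec.Code.primrec_evaln.comp (.pair (.pair .snd (.const c))
      (Primrec.encode.comp .fst))), fun a => ?_⟩
  have h : p a ↔ (c.eval (encode a)).Dom := by
    simp [hc, Part.assert]
  rw [h, Part.dom_iff_mem]
  simp only [Nat.Partrec.Code.evaln_complete, Option.isSome_iff_exists, Option.mem_def]
  exact exists_comm

/-- The list of the values of a function at the numbers below `n`. -/
theorem recursiveIn_map_range {O : Set (ℕ →. ℕ)} {h : ℕ → ℕ}
    (hh : Nat.RecursiveIn O fun n => Part.some (h n)) :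
    Nat.RecursiveIn O fun n => Part.some (encode ((List.range n).map h)) := by
  have hc : Computable fun n : ℕ =>
      encode (((decode n.unpair.1 : Option (List ℕ)).getD []) ++ [n.unpair.2]) :=
    Computable.encode.comp (Computable.list_concat.comp
      (Computable.option_getD (Computable.decode.comp computable_unpair_fst) (.const []))
      computable_unpair_snd)
  have hy : Computable fun n : ℕ => n.unpair.2.unpair.1 :=
    computable_unpair_fst.comp computable_unpair_snd
  have hi : Computable fun n : ℕ => n.unpair.2.unpair.2 :=
    computable_unpair_snd.comp computable_unpair_snd
  have h0 : Nat.RecursiveIn O fun _ => Part.some (encode ([] : List ℕ)) :=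
    Nat.Partrec.recursiveIn (Partrec.nat_iff.1 (Computable.const _))
  have hs := recursiveIn_computable_comp hc (recursiveIn_pair
    (recursiveIn_total_comp recursiveIn_id hi) (recursiveIn_total_comp hh hy))
  have hp : Computable fun n : ℕ => Nat.pair 0 n :=
    Primrec₂.natPair.to_comp.comp (.const 0) .id
  refine (recursiveIn_comp_computable (Nat.RecursiveIn.prec h0 hs) hp).of_eq fun n => ?_
  simp only [Nat.unpair_pair]
  induction n with
  | zero => rfl
  | succ n ih =>
    refine (congrArg (fun p => p >>= _) ih).trans ?_
    simp [List.range_succ]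

/-- An element `b` of `A ⊕ Aᶜ` asserts that the indicator at `b / 2` is `1` for even `b` and `0` for
odd `b`, that is, `1 - b % 2`; a finite table of the indicator can check this. -/
theorem getElem?_indicatorFun {A : Set ℕ} {b N : ℕ} :
    ((List.range N).map (indicatorFun A))[b / 2]? = some (1 - b % 2) ↔
      b / 2 < N ∧ b ∈ join A Aᶜ := by
  have h : b ∈ join A Aᶜ ↔ indicatorFun A (b / 2) = 1 - b % 2 := by
    rcases Nat.even_or_odd' b with ⟨n, rfl | rfl⟩
    · rw [two_mul_mem_join]
      by_cases hn : n ∈ A <;> simp [indicatorFun, hn]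
    · rw [two_mul_add_one_mem_join, show (2 * n + 1) / 2 = n by lia,
        show 1 - (2 * n + 1) % 2 = 0 by lia]
      by_cases hn : n ∈ A <;> simp [indicatorFun, hn]
  rw [h]
  by_cases hb : b / 2 < N <;> simp [hb]

theorem EnumReducible.partrecRelative {k : ℕ} {A : Set ℕ} {f : List.Vector ℕ k →. ℕ}
    (hf : EnumReducible (graph f) (join A Aᶜ)) : PartrecRelative A f := by
  obtain ⟨W, hW, hWf⟩ := hf
  obtain ⟨q, hq, hqW⟩ := REPred.exists_primrec hW
  have hA : Nat.RecursiveIn {(indicatorFun A : ℕ →. ℕ)} fun n => Part.some (indicatorFun A n) :=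
    .oracle _ (Set.mem_singleton _)
  -- A search index is read as the code of `(N, y, D, s)`: table length, value, finite set,
  -- enumeration stage. Its first unpaired component is `N`, so the oracle attaches the table of
  -- length `N`.
  have ht := recursiveIn_pair recursiveIn_id
    (recursiveIn_total_comp (recursiveIn_map_range hA) computable_unpair_fst)
  let P (v : List.Vector ℕ k) (w : (ℕ × ℕ × List ℕ × ℕ) × List ℕ) : Prop :=
    (∀ b ∈ w.1.2.2.1, w.2[b / 2]? = some (1 - b % 2)) ∧
      q ((v, w.1.2.1), w.1.2.2.1) w.1.2.2.2 = true
  have hP : PrimrecRel P := by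
    have hR : PrimrecRel fun (b : ℕ) (t : List ℕ) => t[b / 2]? = some (1 - b % 2) :=
      Primrec.eq.comp (Primrec.list_getElem?.comp .snd (Primrec.nat_div.comp .fst (.const 2)))
        (Primrec.option_some.comp (Primrec.nat_sub.comp (.const 1)
          (Primrec.nat_mod.comp .fst (.const 2))))
    have h₁ : Primrec fun p : List.Vector ℕ k × (ℕ × ℕ × List ℕ × ℕ) × List ℕ => p.2.1.2 :=
      Primrec.snd.comp (Primrec.fst.comp .snd)
    have hD := Primrec.fst.comp (Primrec.snd.comp h₁)
    refine PrimrecPred.and (hR.forall_mem_list.comp hD (Primrec.snd.comp .snd))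
      (Primrec.eq.comp (hq.comp (.pair (.pair .fst (Primrec.fst.comp h₁)) hD)
        (Primrec.snd.comp (Primrec.snd.comp h₁))) (.const true))
  classical
  let Q (x m : ℕ) : Option ℕ := (decode x : Option (List.Vector ℕ k)).bind fun v =>
    (decode m : Option ((ℕ × ℕ × List ℕ × ℕ) × List ℕ)).bind fun w =>
      if P v w then some w.1.2.1 else none
  have hQ : Primrec₂ Q := by
    refine Primrec.option_bind (Primrec.decode.comp .fst) (Primrec.option_bind
      (Primrec.decode.comp (Primrec.snd.comp .fst)) ?_)
    exact Primrec.ite (hP.comp (Primrec.snd.comp .fst) .snd)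
      (Primrec.option_some.comp (Primrec.fst.comp (Primrec.snd.comp (Primrec.fst.comp .snd))))
      (.const none)
  refine recursiveIn_of_search ht hQ.to_comp fun x y => ?_
  have hxy : ∀ v : List.Vector ℕ k, y ∈ f v ↔ ∃ D : List ℕ, ((v, y), D) ∈ W ∧
      ∀ b ∈ D, b ∈ join A Aᶜ := fun v => hWf (v, y)
  simp only [Part.mem_bind_iff, Part.mem_ofOption, Part.mem_map_iff, encode_nat,
    exists_eq_right, Q, Option.bind_eq_some_iff, Option.mem_def, hxy]
  rw [exists_comm]
  refine exists_congr fun v => ?_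
  rw [exists_and_left]
  refine and_congr_right fun _ => ?_
  constructor
  · rintro ⟨D, hD, hT⟩
    obtain ⟨s, hs⟩ := (hqW _).1 hD
    -- Every `b ∈ D` is at most `D.sum`, so this table covers all the positions `b / 2`.
    refine ⟨encode (D.sum + 1, y, D, s),
      ((D.sum + 1, y, D, s), (List.range (D.sum + 1)).map (indicatorFun A)), ?_, ?_⟩
    · rw [← encodek ((D.sum + 1, y, D, s), (List.range (D.sum + 1)).map (indicatorFun A))]
      simp [encode_prod_val]
    · rw [if_pos]
      refine ⟨fun b hb => getElem?_indicatorFun.2 ⟨?_, hT b hb⟩, hs⟩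
      have := List.le_sum_of_mem hb
      lia
  · rintro ⟨n, w, hw, h⟩
    split_ifs at h with hP
    -- The type of quadruples is denumerable, so every search index is a code.
    obtain ⟨⟨N, y', D, s⟩, rfl⟩ : ∃ u : ℕ × ℕ × List ℕ × ℕ, n = encode u :=
      ⟨Denumerable.ofNat _ n, (Denumerable.encode_ofNat n).symm⟩
    have e : w = ((N, y', D, s), (List.range N).map (indicatorFun A)) := by
      have : Nat.pair (encode (N, y', D, s)) (encode ((List.range
          (encode (N, y', D, s)).unpair.1).map (indicatorFun A))) =
          encode ((N, y', D, s), (List.range N).map (indicatorFun A)) := by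
        simp [encode_prod_val]
      rw [this, encodek] at hw
      exact (Option.some_inj.1 hw).symm
    subst e
    obtain rfl : y' = y := Option.some_inj.1 h
    exact ⟨D, (hqW _).2 ⟨s, hP.2⟩, fun b hb => (getElem?_indicatorFun.1 (hP.1 b hb)).2⟩

end FunClass

theorem mainTheorem1 (K : FunClass.PFunClass)
    (hclosure : FunClass.ClosureProperties K)
    (hrecords : FunClass.ComputationRecords K)
    (hprograms : FunClass.Programs K) :
    ∃ A : Set ℕ, ∀ (k : ℕ) (f : List.Vector ℕ k →. ℕ),
      (f ∈ K k ↔ FunClass.PartrecRelative A f) ∧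
      (f ∈ K k ↔ FunClass.EnumReducible (FunClass.graph f) (FunClass.join A Aᶜ)) := by
  obtain ⟨A, hA⟩ :=
    FunClass.exists_forall_mem_iff_partrecRelative hclosure hrecords hprograms
  exact ⟨A, fun k f => ⟨hA k f, (hA k f).trans
    ⟨FunClass.PartrecRelative.enumReducible, FunClass.EnumReducible.partrecRelative⟩⟩⟩
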